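/- Let $1\le p<\infty$, let $A$ be a positive integer, let $b,\lambda\in\mathbb{C}$ with $\lambda\neq 0$, let $\alpha$ be a real number with $\alpha>|b/\lambda|$, and put $g(z)=bz^A$ for $z\in\mathbb{C}$. Let $dA(z)$ denote Lebesgue area measure on $\mathbb{C}$, and let $\mathcal{F}^p_{\alpha,A}$ be the space of entire functions $h$ with $\int_{\mathbb{C}}\bigl|h(z)e^{-\alpha|z|^A}\bigr|^p\,dA(z)<\infty$. Then there is a constant $C>0$, depending only on $p,\alpha,A,b,\lambda$, such that for every entire function $f$ with $fe^{g/\lambda}\in\mathcal{F}^p_{\alpha,A}$, $$\int_{\mathbb{C}}|f(z)|^p\,\bigl|e^{g(z)/\lambda}\bigr|^p e^{-p\alpha|z|^A}\,dA(z)\le C\left(|f(0)|^p+\int_{\mathbb{C}}|f'(z)|^p\,\bigl|e^{g(z)/\lambda}\bigr|^p\,\frac{e^{-p\alpha|z|^A}}{(1+|z|)^{(A-1)p}}\,dA(z)\right).$$ -/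

import Mathlib

open MeasureTheory

/-- The generalized Fock space of exponent `p` and parameters `α`, `A`: the entire functions `f`
such that `z ↦ |f z * exp (-α * |z| ^ A)| ^ p` has a finite integral with respect to the Lebesgue
area measure on `ℂ`. -/
def fockSpace (p α A : ℝ) : Set (ℂ → ℂ) :=
  {f | Differentiable ℂ f ∧
    ∫⁻ z : ℂ, ENNReal.ofReal ((‖f z‖ * Real.exp (-α * ‖z‖ ^ A)) ^ p) < ⊤}

/-!
Write the weight as `exp (-p * ψ)`, where `ψ (r * u) - c * r ^ a` is increasing in `r` for every
unit vector `u`. By the fundamental theorem of calculus along rays, the estimate reduces outside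
the unit disc to a weighted Hardy inequality for `v ↦ ∫₁ʳ v`. Hölder's inequality against the
density of `exp (c * s ^ a)`, followed by Tonelli, turns it into a bound for the tail
`∫ₛ^∞ r * exp (-c * r ^ a) dr`, because the remaining factor `exp (-p * (ψ - c * r ^ a))`
decreases along the ray. The derivative on the unit disc is controlled pointwise by the sub-mean
value property. In the theorem, `ψ z = α * |z| ^ A - Re (b / l * z ^ A)`, `a = A` and
`c = α - |b / l|`.
-/

section HalfLine

open Set Filter Topology ENNReal

theorem rpow_lintegral_le_lintegral_rpow_mul_rpow {X : Type*} [MeasurableSpace X] {μ : Measure X}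
    {p : ℝ} (hp : 1 ≤ p) {v k : X → ℝ≥0∞} (hv : AEMeasurable v μ) (hk : AEMeasurable k μ)
    (hk_zero : ∀ᵐ x ∂μ, k x ≠ 0) (hk_top : ∀ᵐ x ∂μ, k x ≠ ⊤) :
    (∫⁻ x, v x ∂μ) ^ p ≤ (∫⁻ x, v x ^ p * k x ^ (1 - p) ∂μ) * (∫⁻ x, k x ∂μ) ^ (p - 1) := by
  have hp₀ : 0 < p := by linarith
  have hq : 0 ≤ 1 - p⁻¹ := sub_nonneg.2 (inv_le_one_of_one_le₀ hp)
  have hp_cancel : p * p⁻¹ = 1 := mul_inv_cancel₀ hp₀.ne'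
  have hfactor : ∀ᵐ x ∂μ, v x = (v x ^ p * k x ^ (1 - p)) ^ p⁻¹ * k x ^ (1 - p⁻¹) := by
    filter_upwards [hk_zero, hk_top] with x hx_zero hx_top
    have hexp : (1 - p) * p⁻¹ + (1 - p⁻¹) = 0 := by linear_combination -hp_cancel
    rw [ENNReal.mul_rpow_of_nonneg _ _ (by positivity), ← ENNReal.rpow_mul, ← ENNReal.rpow_mul,
      mul_assoc, ← ENNReal.rpow_add _ _ hx_zero hx_top, hp_cancel, hexp]
    simp
  have hholder : ∫⁻ x, v x ∂μ ≤
      (∫⁻ x, v x ^ p * k x ^ (1 - p) ∂μ) ^ p⁻¹ * (∫⁻ x, k x ∂μ) ^ (1 - p⁻¹) :=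
    (lintegral_congr_ae hfactor).trans_le
      (ENNReal.lintegral_mul_norm_pow_le (by fun_prop) hk (by positivity) hq (by ring))
  refine (ENNReal.rpow_le_rpow hholder hp₀.le).trans_eq ?_
  have hexp : (1 - p⁻¹) * p = p - 1 := by linear_combination -hp_cancel
  rw [ENNReal.mul_rpow_of_nonneg _ _ hp₀.le, ← ENNReal.rpow_mul, ← ENNReal.rpow_mul,
    inv_mul_cancel₀ hp₀.ne', ENNReal.rpow_one, hexp]

section LinearOrder

variable {X : Type*} [TopologicalSpace X] [LinearOrder X] [OrderClosedTopology X]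
  [SecondCountableTopology X] [MeasurableSpace X] [OpensMeasurableSpace X]
  {μ : Measure X} [SFinite μ]

theorem lintegral_Ioi_mul_lintegral_Ioc {F G : X → ℝ≥0∞} (hF : Measurable F)
    (hG : Measurable G) (t : X) :
    ∫⁻ r in Ioi t, (∫⁻ s in Ioc t r, F s ∂μ) * G r ∂μ =
      ∫⁻ s in Ioi t, F s * ∫⁻ r in Ici s, G r ∂μ ∂μ := by
  let T : Set (X × X) := {x | x.2 ≤ x.1}
  let H : X → X → ℝ≥0∞ := fun r s => T.indicator (fun x => F x.2 * G x.1) (r, s)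
  have hH : Measurable (Function.uncurry H) :=
    ((hF.comp measurable_snd).mul (hG.comp measurable_fst)).indicator
      (measurableSet_le measurable_snd measurable_fst)
  have hleft : ∀ r, (∫⁻ s in Ioc t r, F s ∂μ) * G r = ∫⁻ s in Ioi t, H r s ∂μ := fun r => by
    rw [← lintegral_mul_const _ hF, ← Ioi_inter_Iic, inter_comm,
      ← Measure.restrict_restrict measurableSet_Iic, ← lintegral_indicator measurableSet_Iic]
    rfl
  have hright : ∀ s ∈ Ioi t, F s * ∫⁻ r in Ici s, G r ∂μ = ∫⁻ r in Ioi t, H r s ∂μ := by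
    intro s hs
    rw [← lintegral_const_mul _ hG, ← inter_eq_left.2 (Ici_subset_Ioi.2 hs),
      ← Measure.restrict_restrict measurableSet_Ici, ← lintegral_indicator measurableSet_Ici]
    rfl
  simp_rw [hleft]
  rw [setLIntegral_congr_fun measurableSet_Ioi hright]
  exact lintegral_lintegral_swap hH.aemeasurable

theorem measurable_lintegral_Ioc {Y : Type*} [MeasurableSpace Y] {F : Y → X → ℝ≥0∞} {b : Y → X}
    (hF : Measurable (Function.uncurry F)) (hb : Measurable b) (t : X) :
    Measurable fun y => ∫⁻ s in Ioc t (b y), F y s ∂μ := by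
  let T : Set (Y × X) := {x | x.2 ≤ b x.1}
  have hT : MeasurableSet T := measurableSet_le measurable_snd (hb.comp measurable_fst)
  convert (hF.indicator hT).lintegral_prod_right' (ν := μ.restrict (Ioi t)) using 2 with y
  rw [← Ioi_inter_Iic, inter_comm, ← Measure.restrict_restrict measurableSet_Iic,
    ← lintegral_indicator measurableSet_Iic]
  rfl

theorem lintegral_rpow_lintegral_Ioc_mul_le {p : ℝ} (hp : 1 ≤ p) {t : X} {v k G : X → ℝ≥0∞}
    (hv : Measurable v) (hk : Measurable k) (hG : Measurable G)
    (hk_zero : ∀ s ∈ Ioi t, k s ≠ 0) (hk_top : ∀ s ∈ Ioi t, k s ≠ ⊤) :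
    ∫⁻ r in Ioi t, (∫⁻ s in Ioc t r, v s ∂μ) ^ p * G r ∂μ ≤
      ∫⁻ s in Ioi t, v s ^ p * k s ^ (1 - p) *
        ∫⁻ r in Ici s, (∫⁻ s in Ioc t r, k s ∂μ) ^ (p - 1) * G r ∂μ ∂μ := by
  have hprimitive : Measurable fun r => ∫⁻ s in Ioc t r, k s ∂μ :=
    measurable_lintegral_Ioc (F := fun _ => k) (hk.comp measurable_snd) measurable_id t
  rw [← lintegral_Ioi_mul_lintegral_Ioc (by fun_prop) (by fun_prop)]
  refine lintegral_mono fun r => ?_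
  rw [← mul_assoc]
  gcongr
  refine rpow_lintegral_le_lintegral_rpow_mul_rpow hp hv.aemeasurable hk.aemeasurable ?_ ?_ <;>
    filter_upwards [ae_restrict_mem measurableSet_Ioc] with s hs
  exacts [hk_zero s hs.1, hk_top s hs.1]

end LinearOrder

theorem lintegral_Ioi_ofReal_of_hasDerivAt_of_nonneg {g g' : ℝ → ℝ} {t l : ℝ}
    (hderiv : ∀ x ∈ Ici t, HasDerivAt g (g' x) x) (g'pos : ∀ x ∈ Ioi t, 0 ≤ g' x)
    (hg : Tendsto g atTop (𝓝 l)) :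
    ∫⁻ x in Ioi t, ENNReal.ofReal (g' x) = ENNReal.ofReal (l - g t) := by
  rw [← integral_Ioi_of_hasDerivAt_of_nonneg' hderiv g'pos hg, ofReal_integral_eq_lintegral_ofReal
    (integrableOn_Ioi_deriv_of_nonneg' hderiv g'pos hg)]
  exact (ae_restrict_mem measurableSet_Ioi).mono g'pos

/-- The density `d/ds exp (c * s ^ a)`, which serves as the test weight in Hardy's inequality for
weights decaying at least as fast as `exp (-c * s ^ a)`. -/
noncomputable def growthDensity (c a s : ℝ) : ℝ := c * a * s ^ (a - 1) * Real.exp (c * s ^ a)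

section Growth

variable {p a c : ℝ}

theorem hasDerivAt_exp_mul_rpow (ha : 1 ≤ a) (c s : ℝ) :
    HasDerivAt (fun s => Real.exp (c * s ^ a)) (growthDensity c a s) s := by
  refine ((Real.hasDerivAt_rpow_const (Or.inr ha)).const_mul c).exp.congr_deriv ?_
  rw [growthDensity]
  ring

theorem continuous_growthDensity (ha : 1 ≤ a) (c : ℝ) : Continuous (growthDensity c a) := by
  unfold growthDensity
  have := Real.continuous_rpow_const (q := a) (by linarith)
  have := Real.continuous_rpow_const (q := a - 1) (by linarith)
  fun_prop

theorem growthDensity_pos (ha : 0 < a) (hc : 0 < c) {s : ℝ} (hs : 0 < s) :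
    0 < growthDensity c a s := by
  unfold growthDensity
  positivity

theorem lintegral_Ioc_growthDensity_le (ha : 1 ≤ a) (hc : 0 < c) {t r : ℝ} (ht : 0 ≤ t)
    (htr : t ≤ r) :
    ∫⁻ s in Ioc t r, ENNReal.ofReal (growthDensity c a s) ≤
      ENNReal.ofReal (Real.exp (c * r ^ a)) := by
  have hint := (continuous_growthDensity ha c).intervalIntegrable (μ := volume) t r
  have hnonneg : ∀ᵐ s ∂volume.restrict (Ioc t r), 0 ≤ growthDensity c a s := by
    filter_upwards [ae_restrict_mem measurableSet_Ioc] with s hs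
    exact (growthDensity_pos (by linarith) hc (ht.trans_lt hs.1)).le
  rw [← ofReal_integral_eq_lintegral_ofReal hint.1 hnonneg, ← intervalIntegral.integral_of_le htr,
    intervalIntegral.integral_eq_sub_of_hasDerivAt
      (fun s _ => hasDerivAt_exp_mul_rpow ha c s) hint]
  exact ENNReal.ofReal_le_ofReal (sub_le_self _ (Real.exp_nonneg _))

theorem tendsto_rpow_mul_exp_neg_mul_rpow_atTop (q : ℝ) (ha : 0 < a) (hc : 0 < c) :
    Tendsto (fun r : ℝ => r ^ q * Real.exp (-c * r ^ a)) atTop (𝓝 0) := by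
  refine ((tendsto_rpow_mul_exp_neg_mul_atTop_nhds_zero (q / a) c hc).comp
    (tendsto_rpow_atTop ha)).congr' ?_
  filter_upwards [eventually_ge_atTop 0] with r hr
  simp only [Function.comp_apply]
  rw [← Real.rpow_mul hr, mul_div_cancel₀ _ ha.ne']

-- The summand `(c * a)⁻¹` is there because, for `1 ≤ s ≤ r`, the derivative then dominates
-- `c * a * s ^ (a - 1) * (r * exp (-c * r ^ a))`.
theorem hasDerivAt_neg_add_mul_exp_neg_mul_rpow (ha : 1 ≤ a) (hc : c ≠ 0) (r : ℝ) :
    HasDerivAt (fun r => -((r + (c * a)⁻¹) * Real.exp (-c * r ^ a)))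
      (Real.exp (-c * r ^ a) * (c * a * r ^ (a - 1) * r + (r ^ (a - 1) - 1))) r := by
  have ha₀ : a ≠ 0 := by linarith
  refine (((hasDerivAt_id r).add_const (c * a)⁻¹).mul
    (hasDerivAt_exp_mul_rpow ha (-c) r)).neg.congr_deriv ?_
  simp only [growthDensity, id]
  field_simp
  ring

theorem lintegral_Ici_mul_exp_neg_mul_rpow_le (ha : 1 ≤ a) (hc : 0 < c) {s : ℝ} (hs : 1 ≤ s) :
    ∫⁻ r in Ici s, ENNReal.ofReal (r * Real.exp (-c * r ^ a)) ≤
      ENNReal.ofReal ((c * a * s ^ (a - 1))⁻¹ * ((s + (c * a)⁻¹) * Real.exp (-c * s ^ a))) := by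
  have ha₀ : 0 < a := by linarith
  set g' : ℝ → ℝ := fun r =>
    Real.exp (-c * r ^ a) * (c * a * r ^ (a - 1) * r + (r ^ (a - 1) - 1))
  have hlower : ∀ r ∈ Ioi s, c * a * s ^ (a - 1) * (r * Real.exp (-c * r ^ a)) ≤ g' r := by
    intro r (hr : s < r)
    have hone : 1 ≤ r ^ (a - 1) := Real.one_le_rpow (hs.trans hr.le) (by linarith)
    have hmono : s ^ (a - 1) ≤ r ^ (a - 1) :=
      Real.rpow_le_rpow (by linarith) hr.le (by linarith)
    calc c * a * s ^ (a - 1) * (r * Real.exp (-c * r ^ a))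
        = Real.exp (-c * r ^ a) * (c * a * s ^ (a - 1) * r + 0) := by ring
      _ ≤ Real.exp (-c * r ^ a) * (c * a * r ^ (a - 1) * r + (r ^ (a - 1) - 1)) := by
          have : 0 ≤ r := by linarith
          gcongr
          linarith
  have hnonneg : ∀ r ∈ Ioi s, 0 ≤ g' r := fun r hr => by
    have : 0 < r := by linarith [mem_Ioi.1 hr]
    exact le_trans (by positivity) (hlower r hr)
  have hlim : Tendsto (fun r => -((r + (c * a)⁻¹) * Real.exp (-c * r ^ a))) atTop (𝓝 0) := by
    have h := (tendsto_rpow_mul_exp_neg_mul_rpow_atTop 1 ha₀ hc).add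
      ((tendsto_rpow_mul_exp_neg_mul_rpow_atTop 0 ha₀ hc).const_mul (c * a)⁻¹)
    simpa [add_mul] using h.neg
  calc ∫⁻ r in Ici s, ENNReal.ofReal (r * Real.exp (-c * r ^ a))
      = ∫⁻ r in Ioi s, ENNReal.ofReal (r * Real.exp (-c * r ^ a)) :=
        setLIntegral_congr Ioi_ae_eq_Ici.symm
    _ ≤ ∫⁻ r in Ioi s, ENNReal.ofReal (c * a * s ^ (a - 1))⁻¹ * ENNReal.ofReal (g' r) := by
        refine setLIntegral_mono' measurableSet_Ioi fun r hr => ?_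
        rw [← ENNReal.ofReal_mul (by positivity)]
        refine ENNReal.ofReal_le_ofReal ?_
        rw [le_inv_mul_iff₀ (by positivity)]
        exact hlower r hr
    _ = _ := by
        rw [lintegral_const_mul' _ _ ENNReal.ofReal_ne_top,
          lintegral_Ioi_ofReal_of_hasDerivAt_of_nonneg
            (fun r _ => hasDerivAt_neg_add_mul_exp_neg_mul_rpow ha hc.ne' r) hnonneg hlim,
          ← ENNReal.ofReal_mul (by positivity), zero_sub, neg_neg]

theorem inv_rpow_le_two_rpow_div_one_add_rpow (ha : 1 ≤ a) (hp : 0 ≤ p) {s : ℝ} (hs : 1 ≤ s) :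
    (s ^ ((a - 1) * p))⁻¹ ≤ 2 ^ ((a - 1) * p) / (1 + s) ^ ((a - 1) * p) := by
  have hE : 0 ≤ (a - 1) * p := mul_nonneg (by linarith) hp
  rw [← Real.div_rpow (by norm_num) (by linarith), ← Real.inv_rpow (by linarith)]
  refine Real.rpow_le_rpow (by positivity) ?_ hE
  rw [inv_eq_one_div, div_le_div_iff₀ (by linarith) (by linarith)]
  linarith

/-- The constant in Hardy's inequality for weights decaying at least as fast as
`exp (-c * s ^ a)`. -/
noncomputable def hardyConst (p a c : ℝ) : ℝ :=
  (c * a) ^ (1 - p) * ((c * a)⁻¹ * (1 + (c * a)⁻¹)) * 2 ^ ((a - 1) * p)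

theorem growthDensity_rpow_mul_tail_le (hp : 1 ≤ p) (ha : 1 ≤ a) (hc : 0 < c) {s : ℝ} (hs : 1 ≤ s)
    (y : ℝ) :
    growthDensity c a s ^ (1 - p) * (Real.exp (-p * (y - c * s ^ a)) *
      ((c * a * s ^ (a - 1))⁻¹ * ((s + (c * a)⁻¹) * Real.exp (-c * s ^ a)))) ≤
    hardyConst p a c * (s * (Real.exp (-p * y) / (1 + s) ^ ((a - 1) * p))) := by
  have hs₀ : 0 < s := by linarith
  have hca : 0 < c * a := mul_pos hc (by linarith)
  have hdensity : growthDensity c a s ^ (1 - p) =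
      (c * a) ^ (1 - p) * (s ^ (a - 1)) ^ (1 - p) * Real.exp (c * s ^ a * (1 - p)) := by
    rw [growthDensity, Real.mul_rpow (by positivity) (by positivity),
      Real.mul_rpow hca.le (by positivity), ← Real.exp_mul]
  have hexp : Real.exp (c * s ^ a * (1 - p)) * Real.exp (-p * (y - c * s ^ a)) *
      Real.exp (-c * s ^ a) = Real.exp (-p * y) := by
    rw [← Real.exp_add, ← Real.exp_add]
    ring_nf
  have hpow : (s ^ (a - 1)) ^ (1 - p) * (s ^ (a - 1))⁻¹ = (s ^ ((a - 1) * p))⁻¹ := by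
    rw [← Real.rpow_mul hs₀.le, ← Real.rpow_neg hs₀.le, ← Real.rpow_neg hs₀.le,
      ← Real.rpow_add hs₀]
    ring_nf
  calc _ = (c * a) ^ (1 - p) * ((c * a)⁻¹ * (s + (c * a)⁻¹)) *
        ((s ^ (a - 1)) ^ (1 - p) * (s ^ (a - 1))⁻¹) *
        (Real.exp (c * s ^ a * (1 - p)) * Real.exp (-p * (y - c * s ^ a)) *
          Real.exp (-c * s ^ a)) := by rw [hdensity, mul_inv]; ring
    _ ≤ (c * a) ^ (1 - p) * ((c * a)⁻¹ * ((1 + (c * a)⁻¹) * s)) *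
        (2 ^ ((a - 1) * p) / (1 + s) ^ ((a - 1) * p)) * Real.exp (-p * y) := by
      rw [hexp, hpow]
      gcongr
      · rw [add_mul, one_mul]
        gcongr
        exact le_mul_of_one_le_right (by positivity) hs
      · exact inv_rpow_le_two_rpow_div_one_add_rpow ha (by linarith) hs
    _ = _ := by rw [hardyConst]; ring

theorem lintegral_Ici_rpow_growthDensity_mul_le (hp : 1 ≤ p) (ha : 1 ≤ a) (hc : 0 < c)
    {ψ : ℝ → ℝ} (hψ : MonotoneOn (fun r => ψ r - c * r ^ a) (Ici 1)) {s : ℝ} (hs : 1 ≤ s) :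
    ∫⁻ r in Ici s, (∫⁻ s in Ioc 1 r, ENNReal.ofReal (growthDensity c a s)) ^ (p - 1) *
        ENNReal.ofReal (r * Real.exp (-p * ψ r)) ≤
      ENNReal.ofReal (Real.exp (-p * (ψ s - c * s ^ a)) *
        ((c * a * s ^ (a - 1))⁻¹ * ((s + (c * a)⁻¹) * Real.exp (-c * s ^ a)))) := by
  rw [ENNReal.ofReal_mul (Real.exp_nonneg _)]
  refine le_trans ?_ (mul_le_mul_right (lintegral_Ici_mul_exp_neg_mul_rpow_le ha hc hs) _)
  rw [← lintegral_const_mul' _ _ ENNReal.ofReal_ne_top]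
  refine setLIntegral_mono' measurableSet_Ici fun r hr => ?_
  have hr_one : 1 ≤ r := hs.trans hr
  have hexp : Real.exp (c * r ^ a) ^ (p - 1) * Real.exp (-p * ψ r) =
      Real.exp (-p * (ψ r - c * r ^ a)) * Real.exp (-c * r ^ a) := by
    rw [← Real.exp_mul, ← Real.exp_add, ← Real.exp_add]
    ring_nf
  have hdecay : Real.exp (-p * (ψ r - c * r ^ a)) ≤ Real.exp (-p * (ψ s - c * s ^ a)) :=
    Real.exp_le_exp.2 (mul_le_mul_of_nonpos_left (hψ hs hr_one hr) (by linarith))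
  calc _ ≤ ENNReal.ofReal (Real.exp (c * r ^ a)) ^ (p - 1) *
        ENNReal.ofReal (r * Real.exp (-p * ψ r)) := by
        gcongr
        exact lintegral_Ioc_growthDensity_le ha hc zero_le_one hr_one
    _ = ENNReal.ofReal (Real.exp (-p * (ψ r - c * r ^ a)) * (r * Real.exp (-c * r ^ a))) := by
        rw [ENNReal.ofReal_rpow_of_pos (Real.exp_pos _), ← ENNReal.ofReal_mul (by positivity),
          mul_left_comm, hexp, mul_left_comm]
    _ ≤ _ := by
        rw [ENNReal.ofReal_mul (Real.exp_nonneg _)]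
        gcongr

theorem lintegral_Ioi_one_rpow_lintegral_Ioc_mul_exp_le (hp : 1 ≤ p) (ha : 1 ≤ a) (hc : 0 < c)
    {ψ : ℝ → ℝ} (hψ : Measurable ψ) (hψ_mono : MonotoneOn (fun r => ψ r - c * r ^ a) (Ici 1))
    {v : ℝ → ℝ≥0∞} (hv : Measurable v) :
    ∫⁻ r in Ioi 1, (∫⁻ s in Ioc 1 r, v s) ^ p * ENNReal.ofReal (r * Real.exp (-p * ψ r)) ≤
      ENNReal.ofReal (hardyConst p a c) * ∫⁻ s in Ioi 1, v s ^ p *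
        ENNReal.ofReal (s * (Real.exp (-p * ψ s) / (1 + s) ^ ((a - 1) * p))) := by
  have hpos : ∀ s ∈ Ioi (1 : ℝ), 0 < growthDensity c a s := fun s hs =>
    growthDensity_pos (by linarith) hc (zero_lt_one.trans hs)
  have hk : Measurable fun s => ENNReal.ofReal (growthDensity c a s) :=
    (continuous_growthDensity ha c).measurable.ennreal_ofReal
  refine (lintegral_rpow_lintegral_Ioc_mul_le hp hv hk (by fun_prop)
    (fun s hs => (ENNReal.ofReal_pos.2 (hpos s hs)).ne') (by simp)).trans ?_
  rw [← lintegral_const_mul' _ _ ENNReal.ofReal_ne_top]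
  refine setLIntegral_mono' measurableSet_Ioi fun s hs => ?_
  have hs_one : 1 ≤ s := le_of_lt hs
  have hconst : 0 ≤ hardyConst p a c := by
    unfold hardyConst
    positivity
  rw [mul_assoc, mul_left_comm (ENNReal.ofReal _)]
  refine mul_le_mul_right ?_ _
  rw [ENNReal.ofReal_rpow_of_pos (hpos s hs), ← ENNReal.ofReal_mul hconst]
  refine (mul_le_mul_right
    (lintegral_Ici_rpow_growthDensity_mul_le hp ha hc hψ_mono hs_one) _).trans ?_
  rw [← ENNReal.ofReal_mul (Real.rpow_nonneg (hpos s hs).le _)]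
  exact ENNReal.ofReal_le_ofReal (growthDensity_rpow_mul_tail_le hp ha hc hs_one (ψ s))

end Growth
end HalfLine

section Plane

open Set Metric ENNReal

theorem lintegral_eq_lintegral_circleMap {F : ℂ → ℝ≥0∞} (hF : Measurable F) (c : ℂ) :
    ∫⁻ z, F z = ∫⁻ θ in Ioo (-Real.pi) Real.pi, ∫⁻ r in Ioi (0 : ℝ),
      ENNReal.ofReal r * F (circleMap c r θ) := by
  rw [← lintegral_add_left_eq_self F c, ← Complex.lintegral_comp_polarCoord_symm,
    polarCoord_target, Measure.volume_eq_prod, ← Measure.prod_restrict, lintegral_prod_symm]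
  · simp [circleMap, Complex.exp_mul_I]
  · simp only [Complex.polarCoord_symm_apply, smul_eq_mul]
    fun_prop

theorem setLIntegral_ball_eq_lintegral_circleMap {F : ℂ → ℝ≥0∞} (hF : Measurable F) (c : ℂ)
    (R : ℝ) :
    ∫⁻ z in ball c R, F z = ∫⁻ r in Ioo 0 R, ENNReal.ofReal r *
      ∫⁻ θ in Ioo (-Real.pi) Real.pi, F (circleMap c r θ) := by
  have hcircle : Measurable fun x : ℝ × ℝ => F (circleMap c x.2 x.1) :=
    hF.comp (by unfold circleMap; fun_prop)
  have hradius : ∀ θ, ∫⁻ r in Ioi 0, ENNReal.ofReal r * (ball c R).indicator F (circleMap c r θ) =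
      ∫⁻ r in Ioo 0 R, ENNReal.ofReal r * F (circleMap c r θ) := fun θ => by
    rw [← Ioi_inter_Iio, inter_comm, ← setLIntegral_indicator measurableSet_Iio]
    refine setLIntegral_congr_fun measurableSet_Ioi fun r (hr : 0 < r) => ?_
    simp [indicator, dist_eq_norm, circleMap, abs_of_pos hr]
  rw [← lintegral_indicator measurableSet_ball,
    lintegral_eq_lintegral_circleMap (hF.indicator measurableSet_ball) c]
  simp only [hradius]
  rw [lintegral_lintegral_swap (by simp only [Function.uncurry_def]; fun_prop)]
  refine lintegral_congr fun r => lintegral_const_mul _ ?_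
  exact hcircle.comp (by fun_prop : Measurable fun θ => (θ, r))

/-- A weight exponent `ψ` on the plane grows at least as fast as `c * r ^ a` along every ray from
the origin: the difference is nondecreasing in `r`. -/
def RadialGrowth (ψ : ℂ → ℝ) (c a : ℝ) : Prop :=
  ∀ u : ℂ, ‖u‖ = 1 → MonotoneOn (fun r : ℝ => ψ (r * u) - c * r ^ a) (Ici 0)

/-- The integral of `v` along the part outside the unit disc of the segment from `0` to `z`; it
vanishes for `‖z‖ ≤ 1`, so that the junk direction `0 / ‖0‖` is never used. -/
noncomputable def radialLIntegral (v : ℂ → ℝ≥0∞) (z : ℂ) : ℝ≥0∞ :=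
  ∫⁻ s in Ioc 1 ‖z‖, v (s * (z / ‖z‖))

section

variable {v : ℂ → ℝ≥0∞}

theorem measurable_radialLIntegral (hv : Measurable v) : Measurable (radialLIntegral v) :=
  measurable_lintegral_Ioc (X := ℝ) (F := fun z s => v (s * (z / ‖z‖))) (by fun_prop)
    measurable_norm 1

theorem radialLIntegral_of_norm_le_one (v : ℂ → ℝ≥0∞) {z : ℂ} (hz : ‖z‖ ≤ 1) :
    radialLIntegral v z = 0 := by
  rw [radialLIntegral, Ioc_eq_empty hz.not_gt, setLIntegral_empty]

theorem radialLIntegral_circleMap (v : ℂ → ℝ≥0∞) {r : ℝ} (hr : 0 < r) (θ : ℝ) :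
    radialLIntegral v (circleMap 0 r θ) = ∫⁻ s in Ioc 1 r, v (circleMap 0 s θ) := by
  have hdir : circleMap 0 r θ / (r : ℂ) = Complex.exp (θ * Complex.I) := by
    rw [circleMap_zero, mul_div_cancel_left₀ _ (Complex.ofReal_ne_zero.2 hr.ne')]
  rw [radialLIntegral, norm_circleMap_zero, abs_of_pos hr, hdir]
  simp only [circleMap_zero]

end

variable {p a c : ℝ} {ψ : ℂ → ℝ}

theorem lintegral_radialLIntegral_rpow_mul_exp_le (hp : 1 ≤ p) (ha : 1 ≤ a) (hc : 0 < c)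
    (hψ : Measurable ψ) (hgrowth : RadialGrowth ψ c a) {v : ℂ → ℝ≥0∞} (hv : Measurable v) :
    ∫⁻ z, radialLIntegral v z ^ p * ENNReal.ofReal (Real.exp (-p * ψ z)) ≤
      ENNReal.ofReal (hardyConst p a c) *
        ∫⁻ z, v z ^ p * ENNReal.ofReal (Real.exp (-p * ψ z) / (1 + ‖z‖) ^ ((a - 1) * p)) := by
  have hp₀ : 0 < p := by linarith
  have := measurable_radialLIntegral hv
  rw [lintegral_eq_lintegral_circleMap (by fun_prop) 0,
    lintegral_eq_lintegral_circleMap (by fun_prop) 0, ← lintegral_const_mul' _ _ ofReal_ne_top]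
  refine lintegral_mono fun θ => ?_
  have hcircle : Measurable fun r => circleMap 0 r θ := by unfold circleMap; fun_prop
  have hmono : MonotoneOn (fun r => ψ (circleMap 0 r θ) - c * r ^ a) (Ici 1) := by
    simpa only [circleMap_zero] using (hgrowth _ (Complex.norm_exp_ofReal_mul_I θ)).mono
      (Ici_subset_Ici.2 zero_le_one)
  calc _ = ∫⁻ r in Ioi 1, ENNReal.ofReal r * (radialLIntegral v (circleMap 0 r θ) ^ p *
        ENNReal.ofReal (Real.exp (-p * ψ (circleMap 0 r θ)))) := by
        rw [← Ioc_union_Ioi_eq_Ioi (zero_le_one' ℝ), lintegral_union measurableSet_Ioi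
          (Ioc_disjoint_Ioi le_rfl), setLIntegral_eq_zero measurableSet_Ioc fun r hr => ?_,
          zero_add]
        have hnorm : ‖circleMap 0 r θ‖ ≤ 1 := by simpa [abs_of_pos hr.1] using hr.2
        simp [radialLIntegral_of_norm_le_one v hnorm, hp₀]
    _ = ∫⁻ r in Ioi 1, (∫⁻ s in Ioc 1 r, v (circleMap 0 s θ)) ^ p *
        ENNReal.ofReal (r * Real.exp (-p * ψ (circleMap 0 r θ))) := by
        refine setLIntegral_congr_fun measurableSet_Ioi fun r (hr : 1 < r) => ?_
        simp only [radialLIntegral_circleMap v (zero_lt_one.trans hr)]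
        rw [ofReal_mul (by linarith), mul_left_comm]
    _ ≤ ENNReal.ofReal (hardyConst p a c) * ∫⁻ s in Ioi 1, v (circleMap 0 s θ) ^ p *
        ENNReal.ofReal (s * (Real.exp (-p * ψ (circleMap 0 s θ)) / (1 + s) ^ ((a - 1) * p))) :=
        lintegral_Ioi_one_rpow_lintegral_Ioc_mul_exp_le hp ha hc (hψ.comp hcircle) hmono
          (hv.comp hcircle)
    _ ≤ _ := by
        refine mul_le_mul_right ?_ _
        refine le_trans (setLIntegral_mono' measurableSet_Ioi fun s (hs : 1 < s) => ?_)
          (lintegral_mono_set (Ioi_subset_Ioi zero_le_one))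
        rw [norm_circleMap_zero, abs_of_pos (by linarith), ofReal_mul (by linarith), mul_left_comm]

theorem RadialGrowth.add_mul_norm_rpow_le (hgrowth : RadialGrowth ψ c a) (ha : a ≠ 0) (z : ℂ) :
    ψ 0 + c * ‖z‖ ^ a ≤ ψ z := by
  rcases eq_or_ne z 0 with rfl | hz
  · simp [ha]
  have hnorm : (‖z‖ : ℂ) ≠ 0 := by simpa using hz
  have hunit : ‖z / ‖z‖‖ = 1 := by simp [hz]
  have hle := hgrowth _ hunit self_mem_Ici (norm_nonneg z) (norm_nonneg z)
  simp only [mul_div_cancel₀ z hnorm, Complex.ofReal_zero, zero_mul, Real.zero_rpow ha] at hle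
  linarith

theorem RadialGrowth.lintegral_exp_neg_mul_ne_top (hgrowth : RadialGrowth ψ c a) (ha : 1 ≤ a)
    (hc : 0 < c) (hp : 0 < p) : ∫⁻ z, ENNReal.ofReal (Real.exp (-p * ψ z)) ≠ ⊤ := by
  have ha₀ : 0 < a := by linarith
  have hint : Integrable fun z : ℂ => Real.exp (-(p * c) * ‖z‖ ^ a) := by
    have : 0 < Real.Gamma (2 / a + 1) := Real.Gamma_pos_of_pos (by positivity)
    refine .of_integral_ne_zero ?_
    rw [Complex.integral_exp_neg_mul_rpow ha (mul_pos hp hc)]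
    positivity
  refine ne_top_of_le_ne_top (hint.const_mul (Real.exp (-p * ψ 0))).lintegral_lt_top.ne
    (lintegral_mono fun z => ofReal_le_ofReal ?_)
  rw [← Real.exp_add, Real.exp_le_exp]
  linarith [mul_le_mul_of_nonneg_left (hgrowth.add_mul_norm_rpow_le ha₀.ne' z) hp.le]

end Plane

section Holomorphic

open Set Metric ENNReal

variable {E : Type*} [NormedAddCommGroup E] [NormedSpace ℂ E]

theorem enorm_le_add_lintegral_deriv {f : ℂ → E} (hf : ContDiff ℂ 1 f) {u : ℂ} (hu : ‖u‖ ≤ 1)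
    {r : ℝ} (hr : 0 ≤ r) :
    ‖f (r * u)‖ₑ ≤ ‖f 0‖ₑ + ∫⁻ s in Icc 0 r, ‖deriv f (s * u)‖ₑ := by
  have hderiv : ∀ s : ℝ, deriv (fun s : ℝ => f (s * u)) s = u • deriv f (s * u) := fun s => by
    have hray : HasDerivAt (fun s : ℝ => (s : ℂ) * u) u s := by
      simpa using (Complex.ofRealCLM.hasDerivAt (x := s)).mul_const u
    exact ((hf.differentiable one_ne_zero _).hasDerivAt.scomp s hray).deriv
  have hsmooth : ContDiff ℝ 1 fun s : ℝ => f (s * u) :=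
    (hf.restrict_scalars ℝ).comp (Complex.ofRealCLM.contDiff.mul contDiff_const)
  have hftc := enorm_sub_le_lintegral_deriv_of_contDiffOn_Icc hsmooth.contDiffOn hr
  simp only [hderiv, Complex.ofReal_zero, zero_mul] at hftc
  calc ‖f (r * u)‖ₑ = ‖f 0 + (f (r * u) - f 0)‖ₑ := by rw [add_sub_cancel]
    _ ≤ ‖f 0‖ₑ + ∫⁻ s in Icc 0 r, ‖u • deriv f (s * u)‖ₑ := (enorm_add_le _ _).trans (by gcongr)
    _ ≤ _ := by
      gcongr with s
      rw [enorm_smul]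
      exact mul_le_of_le_one_left' (by simpa [← ofReal_norm] using hu)

theorem enorm_rpow_le_add_radialLIntegral {p : ℝ} (hp : 1 ≤ p) {f : ℂ → E} (hf : ContDiff ℂ 1 f)
    {S : ℝ≥0∞} (hS : ∀ w ∈ closedBall (0 : ℂ) 1, ‖deriv f w‖ₑ ^ p ≤ S) (z : ℂ) :
    ‖f z‖ₑ ^ p ≤ 3 ^ (p - 1) * (‖f 0‖ₑ ^ p + S + radialLIntegral (‖deriv f ·‖ₑ) z ^ p) := by
  have hp₀ : 0 < p := by linarith
  have hroot : ∀ w ∈ closedBall (0 : ℂ) 1, ‖deriv f w‖ₑ ≤ S ^ p⁻¹ := fun w hw =>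
    (le_rpow_inv_iff hp₀).2 (hS w hw)
  have hunit : ‖z / ‖z‖‖ ≤ 1 := by simpa using div_self_le_one ‖z‖
  have hz : z = ‖z‖ * (z / ‖z‖) := by
    rcases eq_or_ne z 0 with rfl | hz
    · simp
    · rw [mul_div_cancel₀ z (by simpa using hz)]
  have hnear : ∫⁻ s : ℝ in Icc 0 1, ‖deriv f (s * (z / ‖z‖))‖ₑ ≤ S ^ p⁻¹ := by
    refine (setLIntegral_mono' measurableSet_Icc fun s hs => hroot _ ?_).trans_eq
      (by simp [Real.volume_Icc])
    rw [mem_closedBall_zero_iff, norm_mul, Complex.norm_of_nonneg hs.1]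
    exact mul_le_one₀ hs.2 (norm_nonneg _) hunit
  have hsum : ‖f z‖ₑ ≤ ‖f 0‖ₑ + S ^ p⁻¹ + radialLIntegral (‖deriv f ·‖ₑ) z := by
    have hftc := enorm_le_add_lintegral_deriv hf hunit (norm_nonneg z)
    rw [← hz] at hftc
    calc ‖f z‖ₑ ≤ ‖f 0‖ₑ + ∫⁻ s : ℝ in Icc 0 ‖z‖, ‖deriv f (s * (z / ‖z‖))‖ₑ := hftc
      _ ≤ ‖f 0‖ₑ + (S ^ p⁻¹ + radialLIntegral (‖deriv f ·‖ₑ) z) := by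
        refine add_le_add_right ?_ _
        refine (lintegral_mono_set (Icc_subset_Icc_union_Ioc (b := 1))).trans ?_
        exact (lintegral_union_le _ _ _).trans (add_le_add_left hnear _)
      _ = _ := (add_assoc _ _ _).symm
  have hpower := rpow_sum_le_const_mul_sum_rpow Finset.univ
    ![‖f 0‖ₑ, S ^ p⁻¹, radialLIntegral (‖deriv f ·‖ₑ) z] hp
  simp only [Fin.sum_univ_three, Matrix.cons_val] at hpower
  refine (rpow_le_rpow hsum hp₀.le).trans (hpower.trans_eq ?_)
  rw [rpow_inv_rpow hp₀.ne']
  norm_num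

variable [CompleteSpace E]

theorem two_pi_mul_enorm_le_lintegral_circleMap {f : ℂ → E} {c : ℂ} {r : ℝ}
    (hf : DiffContOnCl ℂ f (ball c |r|)) :
    ENNReal.ofReal (2 * Real.pi) * ‖f c‖ₑ ≤
      ∫⁻ θ in Ioo (-Real.pi) Real.pi, ‖f (circleMap c r θ)‖ₑ := by
  have hmean : ∫ θ in Ioc (-Real.pi) Real.pi, f (circleMap c r θ) = (2 * Real.pi) • f c := by
    have hperiodic : Function.Periodic (fun θ => f (circleMap c r θ)) (2 * Real.pi) :=
      (periodic_circleMap c r).comp f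
    have hshift := hperiodic.intervalIntegral_add_eq (-Real.pi) 0
    rw [← hf.circleAverage, Real.circleAverage_def, smul_inv_smul₀ (by positivity),
      ← zero_add (2 * Real.pi), ← hshift, ← intervalIntegral.integral_of_le
        (by linarith [Real.pi_pos])]
    ring_nf
  calc ENNReal.ofReal (2 * Real.pi) * ‖f c‖ₑ
      = ‖∫ θ in Ioc (-Real.pi) Real.pi, f (circleMap c r θ)‖ₑ := by
        rw [hmean, enorm_smul, Real.enorm_of_nonneg (by positivity)]
    _ ≤ ∫⁻ θ in Ioc (-Real.pi) Real.pi, ‖f (circleMap c r θ)‖ₑ :=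
        enorm_integral_le_lintegral_enorm _
    _ = _ := setLIntegral_congr Ioo_ae_eq_Ioc.symm

theorem volume_ball_mul_enorm_le_lintegral {f : ℂ → E} (hf : Differentiable ℂ f) (c : ℂ) (R : ℝ) :
    volume (ball c R) * ‖f c‖ₑ ≤ ∫⁻ z in ball c R, ‖f z‖ₑ := by
  rw [mul_comm, ← setLIntegral_const,
    setLIntegral_ball_eq_lintegral_circleMap measurable_const,
    setLIntegral_ball_eq_lintegral_circleMap hf.continuous.enorm.measurable]
  refine lintegral_mono fun r => mul_le_mul_right ?_ _
  refine le_of_eq_of_le ?_ (two_pi_mul_enorm_le_lintegral_circleMap hf.diffContOnCl)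
  rw [setLIntegral_const, Real.volume_Ioo, mul_comm]
  ring_nf

theorem volume_ball_mul_enorm_rpow_le_lintegral {p : ℝ} (hp : 1 ≤ p) {f : ℂ → E}
    (hf : Differentiable ℂ f) (c : ℂ) {R : ℝ} (hR : 0 < R) :
    volume (ball c R) * ‖f c‖ₑ ^ p ≤ ∫⁻ z in ball c R, ‖f z‖ₑ ^ p := by
  have hvol_zero : volume (ball c R) ≠ 0 := (measure_ball_pos volume c hR).ne'
  have hvol_top : volume (ball c R) ≠ ⊤ := measure_ball_lt_top.ne
  have hholder := rpow_lintegral_le_lintegral_rpow_mul_rpow (μ := volume.restrict (ball c R)) hp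
    hf.continuous.enorm.measurable.aemeasurable (aemeasurable_const (b := 1)) (by simp) (by simp)
  simp only [one_rpow, mul_one, setLIntegral_one] at hholder
  have hmean := (rpow_le_rpow (volume_ball_mul_enorm_le_lintegral hf c R) (by linarith)).trans
    hholder
  have hsplit : volume (ball c R) ^ p = volume (ball c R) ^ (p - 1) * volume (ball c R) := by
    nth_rw 3 [← rpow_one (volume (ball c R))]
    rw [← rpow_add _ _ hvol_zero hvol_top, sub_add_cancel]
  rw [mul_rpow_of_nonneg _ _ (by linarith), hsplit, mul_assoc, mul_comm (lintegral _ _)] at hmean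
  refine (ENNReal.mul_le_mul_iff_right ?_ ?_).1 hmean
  · exact (rpow_pos hvol_zero.bot_lt hvol_top).ne'
  · exact rpow_ne_top_of_nonneg (by linarith) hvol_top

theorem exists_forall_mem_enorm_rpow_le_lintegral {p : ℝ} (hp : 1 ≤ p) {Q : Set ℂ}
    (hQ : IsCompact Q) {V : ℂ → ℝ} (hV : Continuous V) (hV_pos : ∀ z, 0 < V z) :
    ∃ K : ℝ≥0∞, K ≠ ⊤ ∧ ∀ f : ℂ → E, Differentiable ℂ f → ∀ z ∈ Q,
      ‖f z‖ₑ ^ p ≤ K * ∫⁻ w, ‖f w‖ₑ ^ p * ENNReal.ofReal (V w) := by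
  obtain ⟨m, hm, hm_le⟩ := (hQ.cthickening (r := 1)).exists_forall_le' hV.continuousOn
    fun w _ => hV_pos w
  have hvol_zero : volume (ball (0 : ℂ) 1) ≠ 0 := (measure_ball_pos volume 0 one_pos).ne'
  refine ⟨(volume (ball (0 : ℂ) 1))⁻¹ * ENNReal.ofReal m⁻¹,
    mul_ne_top (inv_ne_top.2 hvol_zero) ofReal_ne_top, fun f hf z hz => ?_⟩
  rw [mul_assoc, ← ENNReal.div_eq_inv_mul, ENNReal.le_div_iff_mul_le (.inl hvol_zero)
    (.inl measure_ball_lt_top.ne), mul_comm, ← Measure.addHaar_ball_center volume z]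
  refine (volume_ball_mul_enorm_rpow_le_lintegral hp hf z one_pos).trans ?_
  rw [← lintegral_const_mul' _ _ ofReal_ne_top]
  refine le_trans (setLIntegral_mono' measurableSet_ball fun w hw => ?_)
    (setLIntegral_le_lintegral (ball z 1) _)
  have hw_mem : w ∈ cthickening 1 Q :=
    mem_cthickening_of_dist_le w z 1 Q hz (mem_ball.1 hw).le
  rw [mul_left_comm, ← ofReal_mul (by positivity)]
  refine le_mul_of_one_le_right' ?_
  rw [one_le_ofReal, ← div_eq_inv_mul, one_le_div hm]
  exact hm_le w hw_mem

end Holomorphic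

section LittlewoodPaley

open Set Metric ENNReal

theorem ofReal_norm_rpow_mul {E : Type*} [SeminormedAddGroup E] {p : ℝ} (hp : 0 ≤ p) (x : E)
    (y : ℝ) :
    ENNReal.ofReal (‖x‖ ^ p * y) = ‖x‖ₑ ^ p * ENNReal.ofReal y := by
  rw [ofReal_mul (by positivity), ← ofReal_rpow_of_nonneg (norm_nonneg x) hp, ofReal_norm]

theorem continuous_exp_neg_mul_div_one_add_norm_rpow {ψ : ℂ → ℝ} (hψ : Continuous ψ) (p q : ℝ) :
    Continuous fun z => Real.exp (-p * ψ z) / (1 + ‖z‖) ^ q := by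
  have hone_add : ∀ z : ℂ, 0 < 1 + ‖z‖ := fun z => by positivity
  have := (by fun_prop : Continuous fun z : ℂ => 1 + ‖z‖).rpow_const (p := q)
    fun z => .inl (hone_add z).ne'
  exact Continuous.div (by fun_prop) this fun z => (Real.rpow_pos_of_pos (hone_add z) q).ne'

variable {E : Type*} [NormedAddCommGroup E] [NormedSpace ℂ E] {p a c : ℝ} {ψ : ℂ → ℝ}

theorem lintegral_enorm_rpow_mul_exp_le_of_deriv_le (hp : 1 ≤ p) (ha : 1 ≤ a) (hc : 0 < c)
    (hψ : Measurable ψ) (hgrowth : RadialGrowth ψ c a) {f : ℂ → E} (hf : ContDiff ℂ 1 f)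
    {S : ℝ≥0∞} (hS : ∀ w ∈ closedBall (0 : ℂ) 1, ‖deriv f w‖ₑ ^ p ≤ S) :
    ∫⁻ z, ‖f z‖ₑ ^ p * ENNReal.ofReal (Real.exp (-p * ψ z)) ≤
      3 ^ (p - 1) * ((‖f 0‖ₑ ^ p + S) * (∫⁻ z, ENNReal.ofReal (Real.exp (-p * ψ z))) +
        ENNReal.ofReal (hardyConst p a c) * ∫⁻ z, ‖deriv f z‖ₑ ^ p *
          ENNReal.ofReal (Real.exp (-p * ψ z) / (1 + ‖z‖) ^ ((a - 1) * p))) := by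
  have hv : Measurable (‖deriv f ·‖ₑ) := (hf.continuous_deriv le_rfl).enorm.measurable
  have := measurable_radialLIntegral hv
  calc ∫⁻ z, ‖f z‖ₑ ^ p * ENNReal.ofReal (Real.exp (-p * ψ z))
      ≤ ∫⁻ z, 3 ^ (p - 1) * ((‖f 0‖ₑ ^ p + S) * ENNReal.ofReal (Real.exp (-p * ψ z)) +
          radialLIntegral (‖deriv f ·‖ₑ) z ^ p * ENNReal.ofReal (Real.exp (-p * ψ z))) := by
        refine lintegral_mono fun z => ?_
        rw [← add_mul, ← mul_assoc]
        gcongr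
        exact enorm_rpow_le_add_radialLIntegral hp hf hS z
    _ = 3 ^ (p - 1) * ((‖f 0‖ₑ ^ p + S) * (∫⁻ z, ENNReal.ofReal (Real.exp (-p * ψ z))) +
          ∫⁻ z, radialLIntegral (‖deriv f ·‖ₑ) z ^ p * ENNReal.ofReal (Real.exp (-p * ψ z))) := by
        rw [lintegral_const_mul _ (by fun_prop), lintegral_add_left (by fun_prop),
          lintegral_const_mul _ (by fun_prop)]
    _ ≤ _ := by
        gcongr
        exact lintegral_radialLIntegral_rpow_mul_exp_le hp ha hc hψ hgrowth hv

variable [CompleteSpace E]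

theorem exists_lintegral_enorm_rpow_mul_exp_le (hp : 1 ≤ p) (ha : 1 ≤ a) (hc : 0 < c)
    (hψ : Continuous ψ) (hgrowth : RadialGrowth ψ c a) :
    ∃ C : ℝ≥0∞, C ≠ ⊤ ∧ ∀ f : ℂ → E, Differentiable ℂ f →
      ∫⁻ z, ‖f z‖ₑ ^ p * ENNReal.ofReal (Real.exp (-p * ψ z)) ≤
        C * (‖f 0‖ₑ ^ p + ∫⁻ z, ‖deriv f z‖ₑ ^ p *
          ENNReal.ofReal (Real.exp (-p * ψ z) / (1 + ‖z‖) ^ ((a - 1) * p))) := by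
  obtain ⟨K, hK, hlocal⟩ := exists_forall_mem_enorm_rpow_le_lintegral (E := E) hp
    (isCompact_closedBall (0 : ℂ) 1)
    (continuous_exp_neg_mul_div_one_add_norm_rpow hψ p ((a - 1) * p)) fun z => by positivity
  set M := ∫⁻ z, ENNReal.ofReal (Real.exp (-p * ψ z))
  set H := ENNReal.ofReal (hardyConst p a c)
  have hM : M ≠ ⊤ := hgrowth.lintegral_exp_neg_mul_ne_top ha hc (by linarith)
  refine ⟨3 ^ (p - 1) * (M + K * M + H), by finiteness, fun f hf => ?_⟩
  set I := ∫⁻ z, ‖deriv f z‖ₑ ^ p *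
    ENNReal.ofReal (Real.exp (-p * ψ z) / (1 + ‖z‖) ^ ((a - 1) * p))
  calc ∫⁻ z, ‖f z‖ₑ ^ p * ENNReal.ofReal (Real.exp (-p * ψ z))
      ≤ 3 ^ (p - 1) * ((‖f 0‖ₑ ^ p + K * I) * M + H * I) :=
        lintegral_enorm_rpow_mul_exp_le_of_deriv_le hp ha hc hψ.measurable hgrowth hf.contDiff
          (hlocal _ hf.contDiff.differentiable_deriv_two)
    _ ≤ 3 ^ (p - 1) * ((‖f 0‖ₑ ^ p + K * I) * M + H * I +
          ((K * M + H) * ‖f 0‖ₑ ^ p + M * I)) :=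
        mul_le_mul_right le_self_add _
    _ = 3 ^ (p - 1) * (M + K * M + H) * (‖f 0‖ₑ ^ p + I) := by ring

theorem proposition2p2_general (hp : 1 ≤ p) (ha : 1 ≤ a) (hc : 0 < c) (hψ : Continuous ψ)
    (hgrowth : RadialGrowth ψ c a) :
    ∃ C : ℝ, 0 < C ∧ ∀ f : ℂ → E, Differentiable ℂ f →
      ∫⁻ z, ENNReal.ofReal (‖f z‖ ^ p * Real.exp (-p * ψ z)) ≤
        ENNReal.ofReal C * (ENNReal.ofReal (‖f 0‖ ^ p) + ∫⁻ z, ENNReal.ofReal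
          (‖deriv f z‖ ^ p * (Real.exp (-p * ψ z) / (1 + ‖z‖) ^ ((a - 1) * p)))) := by
  have hp₀ : 0 ≤ p := by linarith
  obtain ⟨C, hC, hle⟩ := exists_lintegral_enorm_rpow_mul_exp_le (E := E) hp ha hc hψ hgrowth
  refine ⟨C.toReal + 1, by positivity, fun f hf => ?_⟩
  simp only [ofReal_norm_rpow_mul hp₀, ← ofReal_rpow_of_nonneg (norm_nonneg (f 0)) hp₀, ofReal_norm]
  refine (hle f hf).trans (mul_le_mul_left ?_ _)
  rw [← ofReal_toReal hC]
  exact ofReal_le_ofReal (by simp)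

theorem radialGrowth_mul_norm_pow_sub_re (w : ℂ) (α : ℝ) (n : ℕ) :
    RadialGrowth (fun z => α * ‖z‖ ^ n - (w * z ^ n).re) (α - ‖w‖) n := by
  intro u hu
  have hcoeff : 0 ≤ ‖w‖ - (w * u ^ n).re :=
    sub_nonneg.2 ((Complex.re_le_norm _).trans_eq (by simp [hu]))
  have hmono : MonotoneOn (fun r : ℝ => (‖w‖ - (w * u ^ n).re) * r ^ n) (Ici 0) :=
    fun r hr s _ hrs => mul_le_mul_of_nonneg_left (pow_le_pow_left₀ hr hrs n) hcoeff
  refine hmono.congr fun r (hr : 0 ≤ r) => ?_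
  have hre : (w * (r * u) ^ n).re = r ^ n * (w * u ^ n).re := by
    rw [mul_pow, mul_left_comm, ← Complex.ofReal_pow, Complex.re_ofReal_mul]
  simp only [norm_mul, hu, mul_one, Complex.norm_of_nonneg hr, Real.rpow_natCast, hre]
  ring

theorem norm_cexp_rpow_mul_exp (w : ℂ) (p α t : ℝ) :
    ‖Complex.exp w‖ ^ p * Real.exp (-p * α * t) = Real.exp (-p * (α * t - w.re)) := by
  rw [Complex.norm_exp, ← Real.exp_mul, ← Real.exp_add]
  ring_nf

end LittlewoodPaley

theorem proposition2p2 (p : ℝ) (hp : 1 ≤ p) (A : ℕ) (hA : 0 < A) (b l : ℂ) (hl : l ≠ 0)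
    (α : ℝ) (hα : ‖b / l‖ < α) (g : ℂ → ℂ) (hg : ∀ z, g z = b * z ^ A) :
    ∃ C : ℝ, 0 < C ∧ ∀ f : ℂ → ℂ, Differentiable ℂ f →
      (fun z => f z * Complex.exp (g z / l)) ∈ fockSpace p α A →
      ∫⁻ z : ℂ, ENNReal.ofReal
          (‖f z‖ ^ p * ‖Complex.exp (g z / l)‖ ^ p * Real.exp (-p * α * ‖z‖ ^ A)) ≤
        ENNReal.ofReal C *
          (ENNReal.ofReal (‖f 0‖ ^ p) +
            ∫⁻ z : ℂ, ENNReal.ofReal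
              (‖deriv f z‖ ^ p * ‖Complex.exp (g z / l)‖ ^ p *
                (Real.exp (-p * α * ‖z‖ ^ A) / (1 + ‖z‖) ^ (((A : ℝ) - 1) * p)))) := by
  obtain ⟨C, hC, hle⟩ := proposition2p2_general (E := ℂ) hp (Nat.one_le_cast.2 hA)
    (sub_pos.2 hα) (by fun_prop) (radialGrowth_mul_norm_pow_sub_re (b / l) α A)
  refine ⟨C, hC, fun f hf _ => ?_⟩
  simpa only [hg, mul_div_right_comm b, mul_assoc (_ ^ p), ← mul_div_assoc (_ ^ p),
    norm_cexp_rpow_mul_exp] using hle f hf
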